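/- Consider a dynamic matching market in which hard-to-match ($H$) and easy-to-match ($E$) agents arrive according to independent Poisson processes with rates $\lambda_H>0$ and $\lambda_E>0$. Each agent arrives with one item. An agent of type $T\in\{H,E\}$ finds the item of any other agent compatible with probability $p_T$, independently over all ordered pairs of agents, and leaves when she receives a compatible item. Under the policy ChainMatch($d$) there are always exactly $d$ bridge (or altruistic) agents, each of whom has an item left to give. When an agent arrives who finds no bridge agent's item compatible, she joins the waiting agents. Otherwise one of the bridge agents whose item she finds compatible, chosen uniformly at random, gives her its item, and a chain-segment starts with her. The chain-segment is extended by local search: if some waiting agents who are not yet in the chain-segment find the item of its last agent compatible, one of them receives this item and becomes the last agent; she is chosen uniformly at random among the $H$ agents of this kind if there are any, and among the $E$ agents of this kind otherwise. This is repeated as long as possible and takes no time. All agents of the chain-segment stop waiting, and its last agent becomes a bridge agent in place of the one that started it. The numbers $(H_t,E_t)$ of waiting $H$ and $E$ agents form a continuous-time Markov chain. Let $w_H$ be the average waiting time of $H$ agents in steady state, that is, the expected time between the arrival and the matching of an $H$ agent who arrives when $(H_t,E_t)$ has its stationary distribution (the waiting time is $0$ if she is matched on arrival). Let $p_E=1$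 and let $d\ge 1$ be a constant integer (independent of $p_H$). For every $p_H\in(0,1)$ the chain $(H_t,E_t)$ has a unique stationary distribution and $w_H<\infty$, and $$\lim_{p_H\to 0^+} p_H\, w_H=\frac{\ln\left(\frac{\lambda_H}{\lambda_E}+1\right)}{\lambda_H}.$$ In particular this limit does not depend on $d$. Consequently the limit is strictly decreasing in $\lambda_E$ for each fixed $\lambda_H$, and strictly decreasing in $\lambda_H$ for each fixed $\lambda_E$. -/

import Mathlib

open Filter Topology

noncomputable section

namespace ChainMatching

/-- The two types of agents: hard-to-match and easy-to-match. -/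
inductive AgentType
  | H
  | E

/-- The parameters of a market run under ChainMatch(`d`): the Poisson arrival rates `lamH`, `lamE`
of the two types, the probabilities `pH`, `pE` with which an agent of type `H`, `E` finds any given
item compatible, and the number `d` of altruistic/bridge agents present at any time. -/
structure Market where
  lamH : ℝ
  lamE : ℝ
  pH : unitInterval
  pE : unitInterval
  d : ℕ

/-- A pool of waiting agents: the labels of the waiting `H` agents and of the waiting `E` agents. -/
abbrev Pool : Type := Finset ℕ × Finset ℕ

/-- A state `(h, e)` of the market: the numbers of waiting `H` agents and `E` agents. -/
abbrev State : Type := ℕ × ℕ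

/-- The numbers of waiting agents in a pool. -/
def Pool.counts (P : Pool) : State := (P.1.card, P.2.card)

theorem sum_edge_weights (p : unitInterval) (A : Finset ℕ) :
    ∑ S ∈ A.powerset, (if S ⊆ A then
      ENNReal.ofReal (p : ℝ) ^ S.card * ENNReal.ofReal (1 - (p : ℝ)) ^ (A.card - S.card)
      else 0) = 1 := by
  rw [Finset.sum_congr rfl (fun S hS => if_pos (Finset.mem_powerset.mp hS)),
    Finset.sum_pow_mul_eq_add_pow,
    ← ENNReal.ofReal_add p.2.1 (by linarith [p.2.2])]
  simp

/-- The random subset of `A` that contains each element of `A` independently with probability `p`.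
It is used for the set of all agents in `A` who find a given item compatible, and for the set of all
agents in `A` whose item a given agent finds compatible. -/
def edges (p : unitInterval) (A : Finset ℕ) : PMF (Finset ℕ) :=
  PMF.ofFinset
    (fun S => if S ⊆ A then
      ENNReal.ofReal (p : ℝ) ^ S.card * ENNReal.ofReal (1 - (p : ℝ)) ^ (A.card - S.card)
      else 0)
    A.powerset (sum_edge_weights p A)
    (fun _ hS => if_neg (fun h => hS (Finset.mem_powerset.mpr h)))

namespace Market

variable (M : Market)

/-- The local search that extends a chain-segment, run for at most `n` steps from the pool `P` of
waiting agents who are not yet in the chain-segment; the result is the pool that is left over.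
In each step the edges from the last agent of the chain-segment to the agents of the pool are
revealed (each such edge is examined at most once, so it may be sampled when it is examined).
If there is an edge to an `H` agent, one of these `H` agents, chosen uniformly at random, is matched
and becomes the last agent; otherwise, if there is an edge to an `E` agent, one of these `E` agents,
chosen uniformly at random, is; otherwise the chain-segment ends. -/
def search : ℕ → Pool → PMF Pool
  | 0, P => PMF.pure P
  | n + 1, P =>
    (edges M.pH P.1).bind fun SH =>
    (edges M.pE P.2).bind fun SE =>
      if hH : SH.Nonempty then
        (PMF.uniformOfFinset SH hH).bind fun i => search n (P.1.erase i, P.2)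
      else if hE : SE.Nonempty then
        (PMF.uniformOfFinset SE hE).bind fun i => search n (P.1, P.2.erase i)
      else PMF.pure P

/-- The probability that an agent of type `T` finds a given item compatible. -/
def p : AgentType → unitInterval
  | .H => M.pH
  | .E => M.pE

/-- The arrival rate of agents of type `T`. -/
def lam : AgentType → ℝ
  | .H => M.lamH
  | .E => M.lamE

/-- The pool in which the waiting agents of each type are labelled `0, 1, 2, …`. -/
def pool (x : State) : Pool := (Finset.range x.1, Finset.range x.2)

/-- The state after an agent of type `T` has joined. -/
def join : AgentType → State → State
  | .H, x => (x.1 + 1, x.2)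
  | .E, x => (x.1, x.2 + 1)

/-- The random pool after the arrival of an agent of type `T` in state `x`. If no item of the `d`
bridge agents is compatible for her, she joins the pool. Otherwise she is matched and starts
a chain-segment, which is extended by local search as long as possible (every step removes an agent,
so there are at most `x.1 + x.2` steps). Everyone in the chain-segment leaves the pool;
its last agent replaces the bridge agent that started it. No bridge agent ever has an edge to
a waiting agent, so it does not matter which one starts the chain-segment. -/
def arrive (T : AgentType) (x : State) : PMF Pool :=
  (edges (M.p T) (Finset.range M.d)).bind fun B =>
    if B.Nonempty then M.search (x.1 + x.2) (pool x) else PMF.pure (pool (join T x))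

/-- The rate at which the Markov chain `(H_t, E_t)` jumps from `x` to `y ≠ x`. -/
def rate (x y : State) : ENNReal :=
  ENNReal.ofReal M.lamH * (M.arrive .H x).map Pool.counts y +
    ENNReal.ofReal M.lamE * (M.arrive .E x).map Pool.counts y

/-- `π` is a steady-state distribution of the continuous-time Markov chain `(H_t, E_t)` (whose jump
rates are bounded by `lamH + lamE`): it satisfies the balance equations `π Q = 0`. -/
def IsSteadyState (π : PMF State) : Prop :=
  ∀ y : State,
    ∑' x : {x : State // x ≠ y}, π x * M.rate x y = π y * ∑' z : {z : State // z ≠ y}, M.rate y z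

/-- The probability that an arriving agent is of type `T`. -/
def typeProb (T : AgentType) : ENNReal := ENNReal.ofReal (M.lam T / (M.lamH + M.lamE))

/-- The probability that a tagged waiting `H` agent is still waiting after the next `n` arrivals,
when the current state (which counts the tagged agent) is `x`. Agents are relabelled after every
arrival in such a way that the tagged agent always carries the label `0`. -/
def stillWaiting : ℕ → State → ENNReal
  | 0, _ => 1
  | n + 1, x =>
    M.typeProb .H *
      (∑' P : Pool, M.arrive .H x P * if 0 ∈ P.1 then stillWaiting n (Pool.counts P) else 0) +
    M.typeProb .E *
      (∑' P : Pool, M.arrive .E x P * if 0 ∈ P.1 then stillWaiting n (Pool.counts P) else 0)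

/-- The probability that the tagged `H` agent is still waiting at time `t`, when the state (which
counts her) is `x` at time `0`: the number of arrivals up to time `t` is Poisson distributed with
mean `(lamH + lamE) * t`. -/
def waitingTail (x : State) (t : ℝ) : ENNReal :=
  ∑' n : ℕ, ENNReal.ofReal (Real.exp (-((M.lamH + M.lamE) * t)) *
    ((M.lamH + M.lamE) * t) ^ n / (n.factorial : ℝ)) * M.stillWaiting n x

/-- The expected remaining waiting time `𝐄[W] = ∫₀^∞ 𝐏[W > t] dt` of a waiting `H` agent when the
state (which counts her) is `x`. -/
def meanRemainingWait (x : State) : ENNReal := ∫⁻ t in Set.Ioi (0 : ℝ), M.waitingTail x t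

/-- The expected waiting time of an `H` agent who arrives when the state is distributed according
to `π`. She waits for time `0` if she is matched by a bridge agent on arrival, and joins
the pool otherwise. -/
def meanWaitH (π : PMF State) : ENNReal :=
  ∑' x : State, π x * (edges M.pH (Finset.range M.d) ∅ * M.meanRemainingWait (join .H x))

open Classical in
/-- The steady-state distribution (an arbitrary value if there is none). -/
def steadyState : PMF State :=
  if h : ∃ π : PMF State, M.IsSteadyState π then h.choose else PMF.pure (0, 0)

/-- The average waiting time `w_H` of `H` agents in steady-state, with values in `[0, ∞]`. -/
def wH : ENNReal := M.meanWaitH M.steadyState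

end Market

end ChainMatching

end

/-!
An `E` agent accepts every item, so in steady state no `E` agent is waiting, and the number of
waiting `H` agents is a Markov chain on `ℕ`. Put `q = 1 - p_H` and let `a` be the probability that
an arriving agent is of type `H` and joins the pool. The chain goes up by one with probability `a`;
otherwise a local search takes it down, possibly by many steps. Testing stationarity against
functions whose drift lives on `{n, n + 1}` nevertheless yields the two-term recursion
`(1 - q ^ (k + 1)) π (k + 1) = a π k`, from which the mean of `π` is found to be
`∑ a ^ (m + 1) / (1 - q ^ (m + 1))`. By Little's law this mean is `λ_H w_H`. Multiplication by
`p_H = 1 - q` turns the denominators into `1 + q + ⋯ + q ^ m`, so that for `p_H → 0` the series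
tends, dominated by a geometric one, to that of `-log (1 - λ_H / (λ_H + λ_E))`.
-/

noncomputable section

namespace ChainMatching

/-! ### Series in `[0, ∞]` -/

section Series

open Finset.HasAntidiagonal (antidiagonal)
open scoped ENNReal

variable {f g : ℕ → ℝ≥0∞} {q : ℝ≥0∞}

theorem tsum_ne_top_of_ratio_eventually_le {r : ℝ≥0∞} (hr : r < 1) (hf : ∀ n, f n ≠ ⊤)
    (h : ∀ᶠ n in atTop, f (n + 1) ≤ r * f n) : ∑' n, f n ≠ ⊤ := by
  lift f to ℕ → NNReal using hf
  lift r to NNReal using hr.ne_top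
  rw [ENNReal.tsum_coe_ne_top_iff_summable, ← NNReal.summable_coe]
  refine summable_of_ratio_norm_eventually_le (r := r) (by exact_mod_cast hr) ?_
  filter_upwards [h] with n hn
  rw [NNReal.norm_eq, NNReal.norm_eq]
  exact_mod_cast hn

theorem add_sum_range_eq_of_succ_add_eq (h : ∀ n, f (n + 1) + g n = f n) (n : ℕ) :
    f n + ∑ i ∈ Finset.range n, g i = f 0 := by
  induction n with
  | zero => simp
  | succ n ih => rw [Finset.sum_range_succ, ← ih, ← h n]; ring

theorem tsum_le_of_succ_add_eq (h : ∀ n, f (n + 1) + g n = f n) : ∑' n, g n ≤ f 0 :=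
  ENNReal.tsum_le_of_sum_range_le fun n =>
    le_add_self.trans (add_sum_range_eq_of_succ_add_eq h n).le

theorem tsum_eq_of_succ_add_eq (h : ∀ n, f (n + 1) + g n = f n)
    (hf : Tendsto f atTop (𝓝 0)) : ∑' n, g n = f 0 := by
  have hsum := hf.add (ENNReal.tendsto_nat_tsum g)
  simp only [add_sum_range_eq_of_succ_add_eq h, zero_add] at hsum
  exact tendsto_nhds_unique hsum tendsto_const_nhds

theorem tsum_ne_add {α : Type*} (f : α → ℝ≥0∞) (y : α) :
    ∑' x : {x // x ≠ y}, f x + f y = ∑' x, f x := by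
  rw [← Summable.tsum_add_tsum_compl (s := {y}) ENNReal.summable ENNReal.summable, tsum_singleton,
    add_comm]
  rfl

theorem tendsto_tsum_ennreal_of_dominated_convergence {α : Type*} {F : ℕ → α → ℝ≥0∞}
    {F₀ bound : α → ℝ≥0∞}
    (hbound : ∑' a, bound a ≠ ⊤) (hle : ∀ n a, F n a ≤ bound a)
    (hlim : ∀ a, Tendsto (F · a) atTop (𝓝 (F₀ a))) :
    Tendsto (fun n => ∑' a, F n a) atTop (𝓝 (∑' a, F₀ a)) := by
  let : MeasurableSpace α := ⊤
  simp_rw [← MeasureTheory.lintegral_count] at hbound ⊢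
  exact MeasureTheory.tendsto_lintegral_of_dominated_convergence bound
    (fun _ => measurable_from_top) (fun n => .of_forall (hle n)) hbound (.of_forall hlim)

theorem tsum_sum_antidiagonal_mul (f g : ℕ → ℝ≥0∞) :
    ∑' k, ∑ p ∈ antidiagonal k, f p.1 * g p.2 = (∑' i, f i) * ∑' j, g j := by
  calc ∑' k, ∑ p ∈ antidiagonal k, f p.1 * g p.2
      = ∑' k, ∑' p : antidiagonal k, f p.1.1 * g p.1.2 :=
        tsum_congr fun k => (Finset.tsum_subtype _ fun p : ℕ × ℕ => f p.1 * g p.2).symm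
    _ = ∑' p : ℕ × ℕ, f p.1 * g p.2 := by
        rw [← Finset.HasAntidiagonal.sigmaAntidiagonalEquivProd.tsum_eq, ENNReal.tsum_sigma']; rfl
    _ = (∑' i, f i) * ∑' j, g j := by
        rw [ENNReal.tsum_prod']
        simp_rw [ENNReal.tsum_mul_left, ENNReal.tsum_mul_right]

theorem one_sub_mul_add_mul (hq : q ≤ 1) (x : ℝ≥0∞) : (1 - q) * x + q * x = x := by
  rw [← add_mul, tsub_add_cancel_of_le hq, one_mul]

theorem one_sub_pow_add (hq : q ≤ 1) (i j : ℕ) :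
    1 - q ^ (i + j) = (1 - q ^ i) + q ^ i * (1 - q ^ j) := by
  have hq_top : q ≠ ⊤ := ne_top_of_le_ne_top ENNReal.one_ne_top hq
  rw [ENNReal.mul_sub fun _ _ => ENNReal.pow_ne_top hq_top, mul_one, ← pow_add,
    tsub_add_tsub_cancel (pow_le_one₀ zero_le hq) (pow_le_pow_of_le_one zero_le hq le_self_add)]

theorem one_sub_pow_succ_ne_zero (hq : q < 1) (n : ℕ) : 1 - q ^ (n + 1) ≠ 0 :=
  (tsub_pos_of_lt (pow_lt_one₀ zero_le hq n.succ_ne_zero)).ne'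

end Series

/-! ### The cut equations -/

section BirthDeath

open Finset.HasAntidiagonal (antidiagonal)
open scoped ENNReal

variable {q a : ℝ≥0∞} {v : ℕ → ℝ≥0∞}

/-- The expectation of `g k`, where `k` is the number of waiting agents left over by a local search
from `h` waiting agents, each of whom misses a given item with probability `q`. -/
def searchExpect (q : ℝ≥0∞) (g : ℕ → ℝ≥0∞) : ℕ → ℝ≥0∞
  | 0 => g 0
  | h + 1 => (1 - q ^ (h + 1)) * searchExpect q g h + q ^ (h + 1) * g (h + 1)

/-- The expectation of `g` after one arrival at `h` waiting agents, when the arriving agent joins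
them with probability `a` and starts a local search otherwise. -/
def stepExpect (q a : ℝ≥0∞) (g : ℕ → ℝ≥0∞) (h : ℕ) : ℝ≥0∞ :=
  a * g (h + 1) + (1 - a) * searchExpect q g h

/-- The cut equations of the chain with one-step expectations `stepExpect q a`: the flow out of
`{0, …, k}` equals the flow into it, in the form in which the downward flow from `k + 1` is
expressed through the mass at `k + 1` alone. -/
def IsBalanced (q a : ℝ≥0∞) (v : ℕ → ℝ≥0∞) : Prop :=
  ∀ k, (1 - q ^ (k + 1)) * v (k + 1) = a * v k

/-- The balanced vector with value `1` at `0`. -/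
def weight (q a : ℝ≥0∞) : ℕ → ℝ≥0∞
  | 0 => 1
  | k + 1 => a * weight q a k / (1 - q ^ (k + 1))

/-- The test function that isolates the cut between `n` and `n + 1`: its drift
`stepExpect q a g - g` is supported on `{n, n + 1}`. -/
def cutTest (q : ℝ≥0∞) (n k : ℕ) : ℝ≥0∞ :=
  if k ≤ n then 0 else if k = n + 1 then 1 else q ^ (n + 1)

/-- The mean of a balanced probability vector, see `IsBalanced.tsum_mul`. -/
def balancedMean (q a : ℝ≥0∞) : ℝ≥0∞ := ∑' m : ℕ, a ^ (m + 1) / (1 - q ^ (m + 1))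

theorem searchExpect_le_one (hq : q ≤ 1) {g : ℕ → ℝ≥0∞} (hg : ∀ k, g k ≤ 1) (h : ℕ) :
    searchExpect q g h ≤ 1 := by
  induction h with
  | zero => exact hg 0
  | succ h ih =>
    calc searchExpect q g (h + 1) ≤ (1 - q ^ (h + 1)) * 1 + q ^ (h + 1) * 1 := by
          unfold searchExpect
          gcongr
          exact hg _
      _ = 1 := one_sub_mul_add_mul (pow_le_one₀ zero_le hq) 1

theorem cutTest_le_one (hq : q ≤ 1) (n k : ℕ) : cutTest q n k ≤ 1 := by
  unfold cutTest
  split_ifs <;> simp [pow_le_one₀ zero_le hq]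

theorem searchExpect_cutTest (hq : q ≤ 1) (n k : ℕ) :
    searchExpect q (cutTest q n) k = if k ≤ n then 0 else q ^ (n + 1) := by
  induction k with
  | zero => simp [searchExpect, cutTest]
  | succ k ih =>
    rw [searchExpect, ih]
    rcases lt_trichotomy k n with hk | rfl | hk
    · simp [cutTest, hk.le, Nat.succ_le_of_lt hk]
    · simp [cutTest]
    · simp only [cutTest, hk.not_ge, show ¬ k + 1 ≤ n by omega, hk.ne', if_false, add_left_inj]
      exact one_sub_mul_add_mul (pow_le_one₀ zero_le hq) _

theorem stepExpect_cutTest_add (hq : q ≤ 1) (ha : a ≤ 1) (n k : ℕ) :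
    stepExpect q a (cutTest q n) k + (if k = n + 1 then 1 - q ^ (n + 1) else 0) =
      cutTest q n k + if k = n then a else 0 := by
  rw [stepExpect, searchExpect_cutTest hq]
  rcases lt_trichotomy k n with hk | rfl | hk
  · simp [cutTest, hk.le, hk.ne, Nat.succ_le_of_lt hk, show k ≠ n + 1 by omega]
  · simp [cutTest]
  · have hsucc : cutTest q n (k + 1) = q ^ (n + 1) := by
      simp [cutTest, hk.ne', show ¬ k + 1 ≤ n by omega]
    rw [hsucc, if_neg hk.not_ge, if_neg hk.ne', add_comm (a * _), one_sub_mul_add_mul ha]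
    rcases eq_or_ne k (n + 1) with rfl | hkn
    · simp [cutTest, add_tsub_cancel_of_le (pow_le_one₀ zero_le hq)]
    · simp [cutTest, hk.not_ge, hkn]

theorem isBalanced_of_tsum_stepExpect_eq (hq : q ≤ 1) (ha : a ≤ 1) (hv : ∑' k, v k ≠ ⊤)
    (hstat : ∀ g, ∑' k, v k * stepExpect q a g k = ∑' k, v k * g k) : IsBalanced q a v := by
  intro n
  have hsum : ∑' k, v k * (stepExpect q a (cutTest q n) k +
        if k = n + 1 then 1 - q ^ (n + 1) else 0) =
      ∑' k, v k * (cutTest q n k + if k = n then a else 0) := by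
    simp_rw [stepExpect_cutTest_add hq ha]
  simp only [mul_add, mul_ite, mul_zero, ENNReal.tsum_add, hstat, tsum_ite_eq] at hsum
  rw [mul_comm, mul_comm a]
  refine (ENNReal.add_right_inj (ne_top_of_le_ne_top hv ?_)).1 hsum
  exact ENNReal.tsum_le_tsum fun k => mul_le_of_le_one_right' (cutTest_le_one hq n k)

namespace IsBalanced

theorem tsum_searchExpect (hv : IsBalanced q a v) (g : ℕ → ℝ≥0∞) :
    ∑' k, v k * searchExpect q g k =
      a * ∑' k, v k * searchExpect q g k + ∑' k, q ^ k * v k * g k := by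
  conv_lhs => rw [tsum_eq_zero_add' ENNReal.summable]
  conv_rhs => rw [← ENNReal.tsum_mul_left, tsum_eq_zero_add' (f := fun k => q ^ k * v k * g k)
    ENNReal.summable, add_left_comm, ← ENNReal.tsum_add]
  congr 1
  · simp [searchExpect]
  · refine tsum_congr fun k => ?_
    rw [searchExpect, ← mul_assoc a, ← hv k]
    ring

theorem tsum_stepExpect_eq (hv : IsBalanced q a v) (hq : q ≤ 1) (hv_top : ∑' k, v k ≠ ⊤)
    {g : ℕ → ℝ≥0∞} (hg : ∀ k, g k ≤ 1) :
    ∑' k, v k * stepExpect q a g k = ∑' k, v k * g k := by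
  have hsearch : (1 - a) * ∑' k, v k * searchExpect q g k = ∑' k, q ^ k * v k * g k := by
    have hT : ∑' k, v k * searchExpect q g k ≠ ⊤ := ne_top_of_le_ne_top hv_top <|
      ENNReal.tsum_le_tsum fun k => mul_le_of_le_one_right' (searchExpect_le_one hq hg k)
    have haT : a * ∑' k, v k * searchExpect q g k ≠ ⊤ :=
      ne_top_of_le_ne_top hT (le_self_add.trans_eq (hv.tsum_searchExpect g).symm)
    rw [ENNReal.sub_mul fun _ _ => hT, one_mul]
    exact (ENNReal.eq_sub_of_add_eq haT (by rw [add_comm, ← hv.tsum_searchExpect])).symm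
  have hjoin : a * ∑' k, v k * g (k + 1) = ∑' k, (1 - q ^ k) * v k * g k := by
    rw [tsum_eq_zero_add' (f := fun k => (1 - q ^ k) * v k * g k) ENNReal.summable,
      ← ENNReal.tsum_mul_left]
    simp [hv _, ← mul_assoc]
  calc ∑' k, v k * stepExpect q a g k
      = a * ∑' k, v k * g (k + 1) + (1 - a) * ∑' k, v k * searchExpect q g k := by
        simp_rw [← ENNReal.tsum_mul_left, ← ENNReal.tsum_add, stepExpect]
        exact tsum_congr fun k => by ring
    _ = ∑' k, v k * g k := by
        rw [hsearch, hjoin, ← ENNReal.tsum_add]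
        refine tsum_congr fun k => ?_
        rw [← add_mul, one_sub_mul_add_mul (pow_le_one₀ zero_le hq)]

theorem sum_antidiagonal_eq (hv : IsBalanced q a v) (hq : q ≤ 1) (k : ℕ) :
    ∑ p ∈ antidiagonal k, q ^ p.1 * v p.1 * a ^ p.2 = v k := by
  induction k with
  | zero => simp
  | succ k ih =>
    calc ∑ p ∈ antidiagonal (k + 1), q ^ p.1 * v p.1 * a ^ p.2
        = q ^ (k + 1) * v (k + 1) + a * ∑ p ∈ antidiagonal k, q ^ p.1 * v p.1 * a ^ p.2 := by
          rw [Finset.Nat.sum_antidiagonal_succ', Finset.mul_sum]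
          simp only [pow_zero, mul_one, pow_succ a]
          congr 1
          exact Finset.sum_congr rfl fun p _ => by ring
      _ = v (k + 1) := by
          rw [ih, ← hv k, add_comm, one_sub_mul_add_mul (pow_le_one₀ zero_le hq)]

theorem succ_mul_eq_sum_antidiagonal (hv : IsBalanced q a v) (hq : q < 1) {c : ℕ → ℝ≥0∞}
    (hc : ∀ m, (1 - q ^ (m + 1)) * c m = a ^ (m + 1)) (k : ℕ) :
    (k + 1) * v (k + 1) = ∑ p ∈ antidiagonal k, v p.1 * c p.2 := by
  induction k with
  | zero =>
    rw [← ENNReal.mul_right_inj (one_sub_pow_succ_ne_zero hq 0) (by finiteness)]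
    simpa [mul_left_comm (1 - q), show (1 - q) * c 0 = a by simpa using hc 0, mul_comm] using hv 0
  | succ k ih =>
    have hsplit : ∀ p ∈ antidiagonal (k + 1),
        1 - q ^ (k + 1 + 1) = (1 - q ^ p.1) + q ^ p.1 * (1 - q ^ (p.2 + 1)) := fun p hp => by
      rw [← one_sub_pow_add hq.le, ← add_assoc, Finset.HasAntidiagonal.mem_antidiagonal.1 hp]
    rw [← ENNReal.mul_right_inj (one_sub_pow_succ_ne_zero hq (k + 1)) (by finiteness)]
    calc (1 - q ^ (k + 1 + 1)) * ((↑(k + 1) + 1) * v (k + 1 + 1))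
        = a * ((k + 1) * v (k + 1)) + a * v (k + 1) := by
          rw [mul_left_comm, hv (k + 1)]
          push_cast
          ring
      _ = ∑ p ∈ antidiagonal (k + 1), (1 - q ^ p.1) * v p.1 * c p.2 +
            a * ∑ p ∈ antidiagonal (k + 1), q ^ p.1 * v p.1 * a ^ p.2 := by
          rw [ih, hv.sum_antidiagonal_eq hq.le, Finset.Nat.sum_antidiagonal_succ]
          simp [hv _, Finset.mul_sum, mul_assoc]
      _ = (1 - q ^ (k + 1 + 1)) * ∑ p ∈ antidiagonal (k + 1), v p.1 * c p.2 := by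
          rw [Finset.mul_sum, Finset.mul_sum, ← Finset.sum_add_distrib]
          refine Finset.sum_congr rfl fun p hp => ?_
          rw [hsplit p hp, ← mul_assoc a, mul_comm a, mul_assoc (q ^ _ * _), ← pow_succ', ← hc]
          ring

theorem tsum_mul (hv : IsBalanced q a v) (hq : q < 1) :
    ∑' k : ℕ, k * v k = balancedMean q a * ∑' k, v k := by
  rw [tsum_eq_zero_add' ENNReal.summable, mul_comm (balancedMean q a), balancedMean,
    ← tsum_sum_antidiagonal_mul]
  have hc : ∀ m, (1 - q ^ (m + 1)) * (a ^ (m + 1) / (1 - q ^ (m + 1))) = a ^ (m + 1) := fun m =>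
    ENNReal.mul_div_cancel (one_sub_pow_succ_ne_zero hq m) (by finiteness)
  simp [hv.succ_mul_eq_sum_antidiagonal hq hc]

theorem eq_mul_weight (hv : IsBalanced q a v) (hq : q < 1) (k : ℕ) : v k = v 0 * weight q a k := by
  induction k with
  | zero => simp [weight]
  | succ k ih =>
    rw [weight, ← mul_div_assoc, mul_left_comm, ← ih,
      ENNReal.eq_div_iff (one_sub_pow_succ_ne_zero hq k) (by finiteness), hv k]

end IsBalanced

theorem isBalanced_weight (hq : q < 1) : IsBalanced q a (weight q a) := fun k =>
  ENNReal.mul_div_cancel (one_sub_pow_succ_ne_zero hq k) (by finiteness)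

theorem tsum_weight_ne_zero : ∑' k, weight q a k ≠ 0 := fun h =>
  one_ne_zero (ENNReal.tsum_eq_zero.1 h 0)

theorem tsum_weight_ne_top (hq : q < 1) (ha : a < 1) : ∑' k, weight q a k ≠ ⊤ := by
  obtain ⟨r, har, hr⟩ := exists_between ha
  have hne_top : ∀ k, weight q a k ≠ ⊤ := fun k => by
    induction k with
    | zero => exact ENNReal.one_ne_top
    | succ k ih =>
      exact ENNReal.div_ne_top (ENNReal.mul_ne_top ha.ne_top ih) (one_sub_pow_succ_ne_zero hq k)
  have hlim : Tendsto (fun k => a / (1 - q ^ (k + 1))) atTop (𝓝 a) := by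
    have hpow := (ENNReal.tendsto_pow_atTop_nhds_zero_of_lt_one hq).comp (tendsto_add_atTop_nat 1)
    have hsub := ENNReal.Tendsto.sub (tendsto_const_nhds (x := 1)) hpow (.inl ENNReal.one_ne_top)
    simpa using ENNReal.Tendsto.const_div hsub (.inr ha.ne_top)
  refine tsum_ne_top_of_ratio_eventually_le hr hne_top ?_
  filter_upwards [hlim.eventually_le_const har] with k hk
  rw [weight, mul_comm a, mul_div_assoc, mul_comm]
  gcongr

theorem balancedMean_ne_top (hq : q < 1) (ha : a < 1) : balancedMean q a ≠ ⊤ := by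
  refine ne_top_of_le_ne_top ?_ (ENNReal.tsum_le_tsum fun m =>
    ENNReal.div_le_div_left (tsub_le_tsub_left (pow_le_of_le_one zero_le hq.le m.succ_ne_zero) 1) _)
  simp_rw [div_eq_mul_inv, ENNReal.tsum_mul_right, ENNReal.tsum_geometric_add_one]
  finiteness [(tsub_pos_of_lt hq).ne', (tsub_pos_of_lt ha).ne']

end BirthDeath

/-! ### Random sets of edges -/

/-- The expectation of `f` under `μ`. -/
def expect {α : Type*} (μ : PMF α) (f : α → ENNReal) : ENNReal := ∑' a, μ a * f a

section Expect

variable {α β : Type*}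

theorem expect_pure (a : α) (f : α → ENNReal) : expect (PMF.pure a) f = f a := by
  rw [expect, tsum_eq_single a fun b hb => by simp [PMF.pure_apply, hb]]
  simp

theorem expect_bind (μ : PMF α) (κ : α → PMF β) (f : β → ENNReal) :
    expect (μ.bind κ) f = expect μ fun a => expect (κ a) f := by
  unfold expect
  simp_rw [PMF.bind_apply, ← ENNReal.tsum_mul_right, ← ENNReal.tsum_mul_left]
  rw [ENNReal.tsum_comm]
  simp_rw [mul_assoc]

theorem expect_map (μ : PMF α) (g : α → β) (f : β → ENNReal) :
    expect (μ.map g) f = expect μ (f ∘ g) := by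
  simp_rw [PMF.map, expect_bind, Function.comp_apply, expect_pure]
  rfl

theorem expect_const (μ : PMF α) (c : ENNReal) : expect μ (fun _ => c) = c := by
  rw [expect, ENNReal.tsum_mul_right, μ.tsum_coe, one_mul]

theorem expect_const_mul (μ : PMF α) (c : ENNReal) (f : α → ENNReal) :
    expect μ (fun a => c * f a) = c * expect μ f := by
  simp_rw [expect, mul_left_comm (μ _), ENNReal.tsum_mul_left]

theorem expect_congr {μ : PMF α} {f g : α → ENNReal} (h : ∀ a ∈ μ.support, f a = g a) :
    expect μ f = expect μ g := by
  refine tsum_congr fun a => ?_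
  by_cases ha : μ a = 0
  · simp [ha]
  · rw [h a ((PMF.mem_support_iff μ a).2 ha)]

theorem expect_mono {μ : PMF α} {f g : α → ENNReal} (h : ∀ a, f a ≤ g a) :
    expect μ f ≤ expect μ g :=
  ENNReal.tsum_le_tsum fun a => mul_le_mul_right (h a) _

theorem expect_indicator [DecidableEq α] (μ : PMF α) (a : α) :
    expect μ (fun x => if x = a then 1 else 0) = μ a := by
  simp [expect]

theorem expect_uniformOfFinset (S : Finset α) (hS : S.Nonempty) (f : α → ENNReal) :
    expect (PMF.uniformOfFinset S hS) f = (S.card : ENNReal)⁻¹ * ∑ i ∈ S, f i := by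
  rw [expect, tsum_eq_sum (s := S) fun i hi => by simp [hi], Finset.mul_sum]
  exact Finset.sum_congr rfl fun i hi => by rw [PMF.uniformOfFinset_apply_of_mem hS hi]

end Expect

/-- The probability of not finding a given item compatible. -/
def missProb (p : unitInterval) : ENNReal := ENNReal.ofReal (1 - (p : ℝ))

/-- The probability that a given agent is chosen when one of the agents, among `n`, who find an item
compatible is chosen uniformly at random. The sum is over the number `m` of other agents who find
it compatible. -/
def pickProb (p : unitInterval) (n : ℕ) : ENNReal :=
  ∑ m ∈ Finset.range n, ((n - 1).choose m : ENNReal) *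
    (ENNReal.ofReal (p : ℝ) ^ (m + 1) * missProb p ^ (n - (m + 1)) * ((m + 1 : ℕ) : ENNReal)⁻¹)

section Edges

variable (p : unitInterval)

theorem missProb_le_one : missProb p ≤ 1 := by
  rw [missProb, ENNReal.ofReal_le_one]
  linarith [p.2.1]

variable {p} in
theorem missProb_lt_one (hp : 0 < p) : missProb p < 1 := by
  rw [missProb, ENNReal.ofReal_lt_one]
  linarith [show (0 : ℝ) < p from hp]

theorem subset_of_mem_support_edges {A S : Finset ℕ} (hS : S ∈ (edges p A).support) : S ⊆ A := by
  by_contra hSA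
  exact (PMF.mem_support_iff _ _).1 hS (by rw [edges, PMF.ofFinset_apply, if_neg hSA])

theorem expect_edges (A : Finset ℕ) (f : Finset ℕ → ENNReal) :
    expect (edges p A) f =
      ∑ S ∈ A.powerset, ENNReal.ofReal (p : ℝ) ^ S.card * missProb p ^ (A.card - S.card) * f S := by
  rw [expect, tsum_eq_sum (s := A.powerset) fun S hS => by simp_all [edges]]
  refine Finset.sum_congr rfl fun S hS => ?_
  rw [edges, PMF.ofFinset_apply, if_pos (Finset.mem_powerset.1 hS), missProb]

theorem edges_apply_empty (A : Finset ℕ) : edges p A ∅ = missProb p ^ A.card := by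
  simp [edges, missProb]

theorem edges_empty : edges p ∅ = PMF.pure ∅ := by
  ext S
  rcases eq_or_ne S ∅ with rfl | hS <;> simp [edges, PMF.pure_apply, *]

theorem edges_one (A : Finset ℕ) : edges 1 A = PMF.pure A := by
  ext S
  rw [edges, PMF.ofFinset_apply, PMF.pure_apply]
  rcases eq_or_ne S A with rfl | hne
  · simp
  · rw [if_neg hne]
    split_ifs with hSA
    · have hcard := Finset.card_lt_card (hSA.ssubset_of_ne hne)
      simp [Nat.sub_ne_zero_of_lt hcard]
    · rfl

theorem sum_powerset_ite_mem {A : Finset ℕ} {i : ℕ} (hi : i ∈ A) (F : ℕ → ENNReal) :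
    ∑ S ∈ A.powerset, (if i ∈ S then F S.card else 0) =
      ∑ m ∈ Finset.range A.card, ((A.card - 1).choose m : ENNReal) * F (m + 1) := by
  have hnotMem : ∀ S ∈ (A.erase i).powerset, i ∉ S := fun S hS h =>
    Finset.notMem_erase i A (Finset.mem_powerset.1 hS h)
  calc ∑ S ∈ A.powerset, (if i ∈ S then F S.card else 0)
      = ∑ S ∈ (A.erase i).powerset, F (S.card + 1) := by
        rw [← Finset.insert_erase hi, Finset.sum_powerset_insert (Finset.notMem_erase i A),
          Finset.insert_erase hi, Finset.sum_eq_zero fun S hS => if_neg (hnotMem S hS), zero_add]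
        refine Finset.sum_congr rfl fun S hS => ?_
        rw [if_pos (Finset.mem_insert_self i S), Finset.card_insert_of_notMem (hnotMem S hS)]
    _ = ∑ m ∈ Finset.range A.card, ((A.card - 1).choose m : ENNReal) * F (m + 1) := by
        rw [Finset.sum_powerset_apply_card (fun m => F (m + 1)), Finset.card_erase_add_one hi,
          Finset.card_erase_of_mem hi]
        simp only [nsmul_eq_mul]

theorem expect_edges_pick (A : Finset ℕ) (G : ℕ → ENNReal) (c : ENNReal) :
    expect (edges p A) (fun S =>
      if h : S.Nonempty then expect (PMF.uniformOfFinset S h) G else c) =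
      pickProb p A.card * ∑ i ∈ A, G i + missProb p ^ A.card * c := by
  set w : ℕ → ENNReal := fun m => ENNReal.ofReal (p : ℝ) ^ m * missProb p ^ (A.card - m)
  have hterm : ∀ S ∈ A.powerset, w S.card *
      (if h : S.Nonempty then expect (PMF.uniformOfFinset S h) G else c) =
      (∑ i ∈ A, (if i ∈ S then w S.card * (S.card : ENNReal)⁻¹ else 0) * G i) +
        if S = ∅ then missProb p ^ A.card * c else 0 := by
    intro S hS
    rcases S.eq_empty_or_nonempty with rfl | h
    · simp [w]
    · rw [dif_pos h, if_neg h.ne_empty, expect_uniformOfFinset, add_zero, ← mul_assoc,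
        Finset.mul_sum]
      simp only [ite_mul, zero_mul]
      rw [← Finset.sum_filter, Finset.filter_mem_eq_inter,
        Finset.inter_eq_right.2 (Finset.mem_powerset.1 hS)]
  have hpick : ∀ i ∈ A, ∑ S ∈ A.powerset,
      (if i ∈ S then w S.card * (S.card : ENNReal)⁻¹ else 0) = pickProb p A.card := fun i hi =>
    sum_powerset_ite_mem hi fun m => w m * (m : ENNReal)⁻¹
  rw [expect_edges, Finset.sum_congr rfl hterm, Finset.sum_add_distrib, Finset.sum_comm,
    Finset.mul_sum]
  simp_rw [← Finset.sum_mul]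
  congr 1
  · exact Finset.sum_congr rfl fun i hi => by rw [hpick i hi]
  · simp

theorem pickProb_mul (n : ℕ) : pickProb p n * n = 1 - missProb p ^ n := by
  refine ENNReal.eq_sub_of_add_eq (ENNReal.pow_ne_top ENNReal.ofReal_ne_top) ?_
  simpa [expect_const] using (expect_edges_pick p (Finset.range n) (fun _ => 1) 1).symm

theorem expect_edges_ite (A : Finset ℕ) (b c : ENNReal) :
    expect (edges p A) (fun S => if S.Nonempty then b else c) =
      (1 - missProb p ^ A.card) * b + missProb p ^ A.card * c := by
  simpa [expect_const, ← mul_assoc, pickProb_mul] using expect_edges_pick p A (fun _ => b) c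

end Edges

/-! ### The local search -/

theorem sum_eq_of_card_mul_eq {ι : Type*} {s : Finset ι} (hs : s.Nonempty) {f : ι → ENNReal}
    {c : ENNReal} (h : ∀ i ∈ s, s.card * f i = c) : ∑ i ∈ s, f i = c := by
  rw [← ENNReal.mul_right_inj (a := s.card) (by simp [hs.ne_empty]) (by finiteness),
    Finset.mul_sum, Finset.sum_congr rfl h, Finset.sum_const, nsmul_eq_mul]

namespace Market

variable (M : Market)

section Search

theorem expect_search_succ (n : ℕ) (A : Finset ℕ) (f : Pool → ENNReal) :
    expect (M.search (n + 1) (A, ∅)) f =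
      pickProb M.pH A.card * ∑ i ∈ A, expect (M.search n (A.erase i, ∅)) f +
        missProb M.pH ^ A.card * f (A, ∅) := by
  rw [← expect_edges_pick, search, expect_bind]
  simp only [edges_empty, PMF.pure_bind, Finset.not_nonempty_empty, dite_false]
  congr 1 with S
  split_ifs
  · rw [expect_bind]
  · rw [expect_pure]

theorem expect_search_counts (g : State → ENNReal) {n : ℕ} {A : Finset ℕ} (hA : A.card ≤ n) :
    expect (M.search n (A, ∅)) (g ∘ Pool.counts) =
      searchExpect (missProb M.pH) (fun k => g (k, 0)) A.card := by
  induction n generalizing A with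
  | zero =>
    obtain rfl : A = ∅ := Finset.card_eq_zero.1 (Nat.le_zero.1 hA)
    rw [search, expect_pure]
    rfl
  | succ n ih =>
    rw [expect_search_succ]
    cases hm : A.card with
    | zero => simp [Finset.card_eq_zero.1 hm, searchExpect, Pool.counts]
    | succ m =>
      have hcard : ∀ i ∈ A, (A.erase i).card = m := fun i hi => by
        rw [Finset.card_erase_of_mem hi, hm, Nat.add_sub_cancel]
      rw [Finset.sum_congr rfl fun i hi => by rw [ih (by rw [hcard i hi]; omega), hcard i hi],
        Finset.sum_const, hm, nsmul_eq_mul, ← mul_assoc, pickProb_mul, searchExpect]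
      simp [Pool.counts, hm]

theorem expect_search_of_notMem (g : State → ENNReal) (n : ℕ) {A : Finset ℕ} {i : ℕ}
    (hi : i ∉ A) :
    expect (M.search n (A, ∅)) (fun P => if i ∈ P.1 then g P.counts else 0) = 0 := by
  induction n generalizing A with
  | zero => simp [search, expect_pure, hi]
  | succ n ih =>
    rw [expect_search_succ, Finset.sum_eq_zero fun j _ => ih (mt Finset.mem_of_mem_erase hi)]
    simp [hi]

/-- The waiting `H` agents are exchangeable, so a tagged one is left over with probability equal to
the expected fraction of agents left over. -/
theorem card_mul_expect_search_of_mem (g : State → ENNReal) {n : ℕ} {A : Finset ℕ}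
    (hA : A.card ≤ n) {i : ℕ} (hi : i ∈ A) :
    A.card * expect (M.search n (A, ∅)) (fun P => if i ∈ P.1 then g P.counts else 0) =
      searchExpect (missProb M.pH) (fun k => k * g (k, 0)) A.card := by
  induction n generalizing A with
  | zero => simp [Finset.card_eq_zero.1 (Nat.le_zero.1 hA)] at hi
  | succ n ih =>
    obtain ⟨m, hm⟩ : ∃ m, A.card = m + 1 :=
      Nat.exists_eq_succ_of_ne_zero (Finset.card_ne_zero_of_mem hi)
    have hcard : ∀ j ∈ A, (A.erase j).card = m := fun j hj => by
      rw [Finset.card_erase_of_mem hj, hm, Nat.add_sub_cancel]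
    have hsum : ∑ j ∈ A, expect (M.search n (A.erase j, ∅))
        (fun P => if i ∈ P.1 then g P.counts else 0) =
        searchExpect (missProb M.pH) (fun k => k * g (k, 0)) m := by
      rw [← Finset.add_sum_erase A _ hi,
        expect_search_of_notMem _ _ _ (Finset.notMem_erase i A), zero_add]
      rcases (A.erase i).eq_empty_or_nonempty with hempty | hne
      · rw [← hcard i hi, hempty]
        simp [searchExpect]
      · refine sum_eq_of_card_mul_eq hne fun j hj => ?_
        obtain ⟨hji, hjA⟩ := Finset.mem_erase.1 hj
        rw [hcard i hi, ← hcard j hjA]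
        exact ih (by rw [hcard j hjA]; omega) (Finset.mem_erase.2 ⟨hji.symm, hi⟩)
    rw [expect_search_succ, hsum, mul_add, ← mul_assoc, mul_comm (A.card : ENNReal), pickProb_mul,
      hm, searchExpect]
    simp only [hi, if_true, Pool.counts, hm, Finset.card_empty]
    ring

theorem snd_eq_empty_of_mem_support_search (hE : M.pE = 1) {n : ℕ} {P P' : Pool}
    (hP : P.1.card + P.2.card ≤ n) (hP' : P' ∈ (M.search n P).support) : P'.2 = ∅ := by
  induction n generalizing P with
  | zero =>
    rw [search, PMF.mem_support_pure_iff] at hP'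
    rw [hP', ← Finset.card_eq_zero]
    omega
  | succ n ih =>
    simp only [search, hE, edges_one, PMF.pure_bind, PMF.mem_support_bind_iff] at hP'
    obtain ⟨S, hS, hP'⟩ := hP'
    split_ifs at hP' with hH hE
    · obtain ⟨i, hi, hP'⟩ := (PMF.mem_support_bind_iff _ _ _).1 hP'
      have hiP := subset_of_mem_support_edges _ hS ((PMF.mem_support_uniformOfFinset_iff _ _).1 hi)
      have hcard := Finset.card_erase_add_one hiP
      exact ih (by simp only; omega) hP'
    · obtain ⟨i, hi, hP'⟩ := (PMF.mem_support_bind_iff _ _ _).1 hP'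
      have hcard := Finset.card_erase_add_one ((PMF.mem_support_uniformOfFinset_iff _ _).1 hi)
      exact ih (by simp only; omega) hP'
    · rw [PMF.mem_support_pure_iff] at hP'
      rw [hP', ← Finset.not_nonempty_iff_eq_empty]
      exact hE

end Search

end Market

/-! ### The steady state -/

namespace Market

/-- The parameters for which there is a steady state without waiting `E` agents: both types arrive,
there is a bridge agent, `E` agents accept every item, and `H` agents accept some. -/
structure IsRegular (M : Market) : Prop where
  lamH_pos : 0 < M.lamH
  lamE_pos : 0 < M.lamE
  one_le_d : 1 ≤ M.d
  pE_eq_one : M.pE = 1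
  pH_pos : 0 < M.pH

variable (M : Market)

/-- The probability that an arriving agent is of type `H` and joins the pool. -/
def joinProb : ENNReal := M.typeProb .H * missProb M.pH ^ M.d

/-- The expectation of `f` for the random pool after an arrival in state `x`. -/
def expectNext (x : State) (f : Pool → ENNReal) : ENNReal :=
  M.typeProb .H * expect (M.arrive .H x) f + M.typeProb .E * expect (M.arrive .E x) f

/-- The transition probabilities of the Markov chain embedded at the arrival times. -/
def jumpProb (x y : State) : ENNReal :=
  M.typeProb .H * (M.arrive .H x).map Pool.counts y +
    M.typeProb .E * (M.arrive .E x).map Pool.counts y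

theorem expectNext_comp_counts (x : State) (g : State → ENNReal) :
    M.expectNext x (g ∘ Pool.counts) = ∑' y, M.jumpProb x y * g y := by
  simp only [expectNext, ← expect_map, jumpProb, add_mul, mul_assoc]
  rw [ENNReal.tsum_add, ENNReal.tsum_mul_left, ENNReal.tsum_mul_left]
  rfl

variable {M}

namespace IsRegular

variable (hM : M.IsRegular)
include hM

theorem lam_add_pos : 0 < M.lamH + M.lamE := add_pos hM.lamH_pos hM.lamE_pos

theorem typeProb_add : M.typeProb .H + M.typeProb .E = 1 := by
  simp only [typeProb, lam]
  rw [← ENNReal.ofReal_add (div_nonneg hM.lamH_pos.le hM.lam_add_pos.le)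
    (div_nonneg hM.lamE_pos.le hM.lam_add_pos.le), ← add_div, div_self hM.lam_add_pos.ne',
    ENNReal.ofReal_one]

theorem lam_add_mul_typeProb (T : AgentType) :
    ENNReal.ofReal (M.lamH + M.lamE) * M.typeProb T = ENNReal.ofReal (M.lam T) := by
  rw [typeProb, ← ENNReal.ofReal_mul hM.lam_add_pos.le, mul_div_cancel₀ _ hM.lam_add_pos.ne']

theorem joinProb_lt_one : M.joinProb < 1 := by
  calc M.joinProb ≤ M.typeProb .H :=
        mul_le_of_le_one_right' (pow_le_one₀ zero_le (missProb_le_one _))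
    _ < 1 := by
        rw [typeProb, ENNReal.ofReal_lt_one, div_lt_one hM.lam_add_pos]
        exact lt_add_of_pos_right _ hM.lamE_pos

theorem expect_arrive_E (x : State) (f : Pool → ENNReal) :
    expect (M.arrive .E x) f = expect (M.search (x.1 + x.2) (pool x)) f := by
  rw [arrive, show M.p .E = 1 from hM.pE_eq_one, edges_one, PMF.pure_bind,
    if_pos (Finset.nonempty_range_iff.2 (Nat.one_le_iff_ne_zero.1 hM.one_le_d))]

theorem expectNext_eq (x : State) (f : Pool → ENNReal) :
    M.expectNext x f = M.joinProb * f (pool (join .H x)) +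
      (1 - M.joinProb) * expect (M.search (x.1 + x.2) (pool x)) f := by
  have hmiss : missProb M.pH ^ M.d ≤ 1 := pow_le_one₀ zero_le (missProb_le_one _)
  have hstart : M.typeProb .H * (1 - missProb M.pH ^ M.d) + M.typeProb .E = 1 - M.joinProb := by
    refine ENNReal.eq_sub_of_add_eq hM.joinProb_lt_one.ne_top ?_
    rw [joinProb, add_right_comm, ← mul_add, tsub_add_cancel_of_le hmiss, mul_one, hM.typeProb_add]
  have harrive : expect (M.arrive .H x) f =
      (1 - missProb M.pH ^ M.d) * expect (M.search (x.1 + x.2) (pool x)) f +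
        missProb M.pH ^ M.d * f (pool (join .H x)) := by
    rw [arrive, expect_bind]
    simp only [apply_ite (expect · f), expect_pure]
    rw [expect_edges_ite, Finset.card_range, p]
  rw [expectNext, harrive, hM.expect_arrive_E, ← hstart, joinProb]
  ring

theorem expectNext_zero_comp_counts (g : State → ENNReal) (h : ℕ) :
    M.expectNext (h, 0) (g ∘ Pool.counts) =
      stepExpect (missProb M.pH) M.joinProb (fun k => g (k, 0)) h := by
  have hsearch := M.expect_search_counts g (Finset.card_range h).le
  rw [Finset.card_range] at hsearch
  rw [hM.expectNext_eq, stepExpect, ← hsearch]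
  simp [Pool.counts, pool, join]

theorem tsum_jumpProb (x : State) : ∑' y, M.jumpProb x y = 1 := by
  have hone := M.expectNext_comp_counts x fun _ => 1
  simp only [mul_one] at hone
  simp [← hone, expectNext, Function.comp_def, expect_const, hM.typeProb_add]

theorem rate_eq (x y : State) :
    M.rate x y = ENNReal.ofReal (M.lamH + M.lamE) * M.jumpProb x y := by
  rw [rate, jumpProb, mul_add, ← mul_assoc, ← mul_assoc, hM.lam_add_mul_typeProb,
    hM.lam_add_mul_typeProb]
  rfl

theorem isSteadyState_iff (π : PMF State) :
    M.IsSteadyState π ↔ ∀ y, ∑' x, π x * M.jumpProb x y = π y := by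
  refine forall_congr' fun y => ?_
  simp_rw [hM.rate_eq, mul_left_comm (π _), ENNReal.tsum_mul_left, mul_left_comm (π _)]
  rw [ENNReal.mul_right_inj (by simpa using hM.lam_add_pos) ENNReal.ofReal_ne_top]
  have hle : M.jumpProb y y ≤ 1 := (ENNReal.le_tsum y).trans_eq (hM.tsum_jumpProb y)
  have hdiag : π y * M.jumpProb y y ≠ ⊤ :=
    ENNReal.mul_ne_top (π.apply_ne_top y) (ne_top_of_le_ne_top ENNReal.one_ne_top hle)
  rw [← ENNReal.add_left_inj hdiag, tsum_ne_add (fun x => π x * M.jumpProb x y), ← mul_add,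
    tsum_ne_add, hM.tsum_jumpProb, mul_one]

section SteadyState

variable {π : PMF State} (hπ : M.IsSteadyState π)
include hπ

theorem expect_expectNext (g : State → ENNReal) :
    expect π (fun x => M.expectNext x (g ∘ Pool.counts)) = expect π g := by
  simp_rw [expectNext_comp_counts, expect, ← ENNReal.tsum_mul_left]
  rw [ENNReal.tsum_comm]
  refine tsum_congr fun y => ?_
  rw [← (hM.isSteadyState_iff π).1 hπ y, ← ENNReal.tsum_mul_right]
  simp_rw [mul_assoc]

/-- An `E` agent accepts every item, so no chain-segment ends while one is waiting; hence `E` agents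
can only be waiting after an arrival that found some waiting and joined the pool. -/
theorem eq_zero_of_snd_ne_zero {x : State} (hx : x.2 ≠ 0) : π x = 0 := by
  set g : State → ENNReal := fun y => if y.2 = 0 then 0 else 1
  have hnext : ∀ y, M.expectNext y (g ∘ Pool.counts) = M.joinProb * g y := fun y => by
    rw [hM.expectNext_eq, expect_congr (g := fun _ => 0) fun P hP => ?_, expect_const]
    · simp [g, Pool.counts, pool, join]
    · simp [g, Pool.counts,
        M.snd_eq_empty_of_mem_support_search hM.pE_eq_one (by simp [pool]) hP]
  have hfix : M.joinProb * expect π g = expect π g := by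
    rw [← expect_const_mul, ← hM.expect_expectNext hπ g]
    simp_rw [hnext]
  have hle : expect π g ≤ 1 := by
    refine (expect_mono fun y => ?_).trans_eq (expect_const π 1)
    simp only [g]
    split_ifs <;> simp
  have hzero : expect π g = 0 := by
    by_contra hne
    have hlt := ENNReal.mul_lt_mul_left hne (ne_top_of_le_ne_top ENNReal.one_ne_top hle)
      hM.joinProb_lt_one
    rw [hfix, one_mul] at hlt
    exact hlt.false
  simpa [g, hx] using ENNReal.tsum_eq_zero.1 hzero x

theorem expect_eq_tsum_zero (g : State → ENNReal) :
    expect π g = ∑' h : ℕ, π (h, 0) * g (h, 0) := by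
  rw [expect, ENNReal.tsum_prod (f := fun h e => π (h, e) * g (h, e))]
  refine tsum_congr fun h => tsum_eq_single 0 fun e he => ?_
  rw [hM.eq_zero_of_snd_ne_zero hπ he, zero_mul]

theorem tsum_apply_zero : ∑' h : ℕ, π (h, 0) = 1 := by
  simpa [expect_const] using (hM.expect_eq_tsum_zero hπ fun _ => 1).symm

theorem tsum_mul_stepExpect (g : ℕ → ENNReal) :
    ∑' h, π (h, 0) * stepExpect (missProb M.pH) M.joinProb g h = ∑' h, π (h, 0) * g h := by
  have hstat := hM.expect_expectNext hπ fun y => g y.1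
  simpa only [hM.expect_eq_tsum_zero hπ, hM.expectNext_zero_comp_counts] using hstat

theorem isBalanced_steadyState :
    IsBalanced (missProb M.pH) M.joinProb fun h => π (h, 0) :=
  isBalanced_of_tsum_stepExpect_eq (missProb_le_one _) hM.joinProb_lt_one.le
    (by simp [hM.tsum_apply_zero hπ]) (hM.tsum_mul_stepExpect hπ)

theorem apply_zero_eq (h : ℕ) :
    π (h, 0) = (∑' k, weight (missProb M.pH) M.joinProb k)⁻¹ *
      weight (missProb M.pH) M.joinProb h := by
  have hweight := (hM.isBalanced_steadyState hπ).eq_mul_weight (missProb_lt_one hM.pH_pos)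
  have hsum := hM.tsum_apply_zero hπ
  rw [tsum_congr hweight, ENNReal.tsum_mul_left] at hsum
  rw [hweight, ENNReal.eq_inv_of_mul_eq_one_left hsum]

end SteadyState

theorem exists_isSteadyState : ∃ π, M.IsSteadyState π := by
  have hq := missProb_lt_one hM.pH_pos
  set w := weight (missProb M.pH) M.joinProb
  let ν := PMF.normalize w tsum_weight_ne_zero (tsum_weight_ne_top hq hM.joinProb_lt_one)
  have hν : IsBalanced (missProb M.pH) M.joinProb ν := fun k => by
    rw [PMF.normalize_apply, PMF.normalize_apply, ← mul_assoc, isBalanced_weight hq, mul_assoc]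
  refine ⟨ν.map fun k => (k, 0), (hM.isSteadyState_iff _).2 fun y => ?_⟩
  set g : State → ENNReal := fun x => if x = y then 1 else 0
  have hjump : ∀ x, M.jumpProb x y = M.expectNext x (g ∘ Pool.counts) := fun x => by
    simp [expectNext_comp_counts, g]
  calc ∑' x, ν.map (fun k => (k, 0)) x * M.jumpProb x y
      = ∑' k, ν k * stepExpect (missProb M.pH) M.joinProb (fun k => g (k, 0)) k := by
        simp_rw [hjump, ← hM.expectNext_zero_comp_counts]
        exact expect_map ν (fun k => ((k, 0) : State)) fun x => M.expectNext x (g ∘ Pool.counts)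
    _ = ∑' k, ν k * g (k, 0) :=
        hν.tsum_stepExpect_eq hq.le (by simp [ν.tsum_coe]) fun k => by
          simp only [g]
          split_ifs <;> simp
    _ = ν.map (fun k => (k, 0)) y := by
        rw [← expect_indicator (ν.map _) y, expect_map]
        rfl

theorem existsUnique_isSteadyState : ∃! π, M.IsSteadyState π := by
  refine existsUnique_of_exists_of_unique hM.exists_isSteadyState fun π π' hπ hπ' => ?_
  ext ⟨h, e⟩
  rcases eq_or_ne e 0 with rfl | he
  · rw [hM.apply_zero_eq hπ, hM.apply_zero_eq hπ']
  · rw [hM.eq_zero_of_snd_ne_zero hπ he, hM.eq_zero_of_snd_ne_zero hπ' he]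

theorem isSteadyState_steadyState : M.IsSteadyState M.steadyState := by
  rw [steadyState, dif_pos hM.exists_isSteadyState]
  exact hM.exists_isSteadyState.choose_spec

end IsRegular

end Market

/-! ### Waiting times -/

theorem lintegral_poisson {r : ℝ} (hr : 0 < r) (n : ℕ) :
    ∫⁻ t in Set.Ioi (0 : ℝ),
      ENNReal.ofReal (Real.exp (-(r * t)) * (r * t) ^ n / (n.factorial : ℝ)) =
      (ENNReal.ofReal r)⁻¹ := by
  have hgamma : ∫⁻ t in Set.Ioi (0 : ℝ), ProbabilityTheory.gammaPDF (n + 1) r t = 1 := by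
    have hsplit := MeasureTheory.lintegral_add_compl (μ := MeasureTheory.volume)
      (ProbabilityTheory.gammaPDF (n + 1) r) (measurableSet_Ioi (a := (0 : ℝ)))
    rwa [Set.compl_Ioi, MeasureTheory.setLIntegral_congr MeasureTheory.Iio_ae_eq_Iic.symm,
      ProbabilityTheory.lintegral_gammaPDF_of_nonpos le_rfl, add_zero,
      ProbabilityTheory.lintegral_gammaPDF_eq_one (by positivity) hr] at hsplit
  have hpdf : ∀ t ∈ Set.Ioi (0 : ℝ), ProbabilityTheory.gammaPDF (n + 1) r t =
      ENNReal.ofReal r *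
        ENNReal.ofReal (Real.exp (-(r * t)) * (r * t) ^ n / (n.factorial : ℝ)) := by
    intro t ht
    rw [ProbabilityTheory.gammaPDF_of_nonneg (Set.mem_Ioi.1 ht).le, ← ENNReal.ofReal_mul hr.le,
      Real.Gamma_nat_eq_factorial, add_sub_cancel_right, Real.rpow_natCast, mul_pow,
      Real.rpow_add_one hr.ne', Real.rpow_natCast]
    congr 1
    ring
  rw [MeasureTheory.setLIntegral_congr_fun measurableSet_Ioi hpdf,
    MeasureTheory.lintegral_const_mul _ (by fun_prop), mul_comm] at hgamma
  exact ENNReal.eq_inv_of_mul_eq_one_left hgamma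

namespace Market

/-- The expected number of agents waiting under `π`, a distribution without waiting `E` agents,
who are still waiting after the next `n` arrivals. -/
def meanStillWaiting (M : Market) (π : PMF State) (n : ℕ) : ENNReal :=
  ∑' h : ℕ, π (h, 0) * (h * M.stillWaiting n (h, 0))

/-- The probability that an `H` agent who joins the pool in a state distributed according to `π`,
a distribution without waiting `E` agents, is still waiting after the next `n` arrivals. -/
def joinerStillWaiting (M : Market) (π : PMF State) (n : ℕ) : ENNReal :=
  ∑' h : ℕ, π (h, 0) * M.stillWaiting n (h + 1, 0)

namespace IsRegular

variable {M : Market} (hM : M.IsRegular)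
include hM

theorem stillWaiting_le_one (n : ℕ) (x : State) : M.stillWaiting n x ≤ 1 := by
  induction n generalizing x with
  | zero => exact le_rfl
  | succ n ih =>
    have hle : ∀ μ : PMF Pool,
        expect μ (fun P => if 0 ∈ P.1 then M.stillWaiting n P.counts else 0) ≤ 1 := fun μ => by
      refine (expect_mono fun P => ?_).trans_eq (expect_const μ 1)
      split_ifs
      exacts [ih _, zero_le_one]
    rw [← hM.typeProb_add]
    exact add_le_add (mul_le_of_le_one_right' (hle _)) (mul_le_of_le_one_right' (hle _))

theorem mul_stillWaiting_succ_add (n h : ℕ) :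
    h * M.stillWaiting (n + 1) (h, 0) + M.joinProb * M.stillWaiting n (h + 1, 0) =
      stepExpect (missProb M.pH) M.joinProb (fun k => k * M.stillWaiting n (k, 0)) h := by
  set f : Pool → ENNReal := fun P => if 0 ∈ P.1 then M.stillWaiting n P.counts else 0
  have hsucc : M.stillWaiting (n + 1) (h, 0) = M.joinProb * M.stillWaiting n (h + 1, 0) +
      (1 - M.joinProb) * expect (M.search h (Finset.range h, ∅)) f := by
    refine (hM.expectNext_eq (h, 0) f).trans ?_
    simp [f, Pool.counts, pool, join]
  have hsearch : h * expect (M.search h (Finset.range h, ∅)) f =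
      searchExpect (missProb M.pH) (fun k => k * M.stillWaiting n (k, 0)) h := by
    rcases h with _ | h
    · simp [searchExpect]
    · simpa using M.card_mul_expect_search_of_mem (M.stillWaiting n) (Finset.card_range (h + 1)).le
        (Finset.mem_range.2 h.succ_pos)
  rw [stepExpect, ← hsearch, hsucc]
  push_cast
  ring

theorem meanRemainingWait_eq (x : State) :
    M.meanRemainingWait x = (ENNReal.ofReal (M.lamH + M.lamE))⁻¹ * ∑' n, M.stillWaiting n x := by
  simp only [meanRemainingWait, waitingTail]
  rw [MeasureTheory.lintegral_tsum fun n => by fun_prop, ← ENNReal.tsum_mul_left]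
  refine tsum_congr fun n => ?_
  rw [MeasureTheory.lintegral_mul_const _ (by fun_prop), lintegral_poisson hM.lam_add_pos]

section SteadyState

variable {π : PMF State} (hπ : M.IsSteadyState π)
include hπ

theorem tsum_mul_apply_zero :
    ∑' h : ℕ, π (h, 0) * h = balancedMean (missProb M.pH) M.joinProb := by
  have hmean := (hM.isBalanced_steadyState hπ).tsum_mul (missProb_lt_one hM.pH_pos)
  rw [hM.tsum_apply_zero hπ, mul_one] at hmean
  simpa only [mul_comm] using hmean

theorem meanStillWaiting_zero :
    M.meanStillWaiting π 0 = balancedMean (missProb M.pH) M.joinProb := by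
  simpa [meanStillWaiting, stillWaiting] using hM.tsum_mul_apply_zero hπ

theorem meanStillWaiting_succ_add (n : ℕ) :
    M.meanStillWaiting π (n + 1) + M.joinProb * M.joinerStillWaiting π n =
      M.meanStillWaiting π n := by
  simp only [meanStillWaiting, joinerStillWaiting]
  rw [← hM.tsum_mul_stepExpect hπ fun k => k * M.stillWaiting n (k, 0), ← ENNReal.tsum_mul_left,
    ← ENNReal.tsum_add]
  refine tsum_congr fun h => ?_
  rw [← hM.mul_stillWaiting_succ_add]
  ring

theorem tendsto_joinProb_mul_joinerStillWaiting :
    Tendsto (fun n => M.joinProb * M.joinerStillWaiting π n) atTop (𝓝 0) := by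
  have hle := tsum_le_of_succ_add_eq (hM.meanStillWaiting_succ_add hπ)
  rw [hM.meanStillWaiting_zero hπ] at hle
  exact ENNReal.tendsto_atTop_zero_of_tsum_ne_top <|
    ne_top_of_le_ne_top (balancedMean_ne_top (missProb_lt_one hM.pH_pos) hM.joinProb_lt_one) hle

/-- The cut equations bound the mass of the agents found waiting by that of the agents joining. -/
theorem tendsto_apply_mul_stillWaiting (h : ℕ) :
    Tendsto (fun n => π (h + 1, 0) * M.stillWaiting n (h + 1, 0)) atTop (𝓝 0) := by
  have hcut : (1 - missProb M.pH ^ (h + 1)) * π (h + 1, 0) = M.joinProb * π (h, 0) :=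
    hM.isBalanced_steadyState hπ h
  have hle : ∀ n, (1 - missProb M.pH ^ (h + 1)) * (π (h + 1, 0) * M.stillWaiting n (h + 1, 0)) ≤
      M.joinProb * M.joinerStillWaiting π n := fun n => by
    rw [← mul_assoc, hcut, mul_assoc]
    gcongr
    exact ENNReal.le_tsum (f := fun h : ℕ => π (h, 0) * M.stillWaiting n (h + 1, 0)) h
  have hscaled := tendsto_of_tendsto_of_tendsto_of_le_of_le tendsto_const_nhds
    (hM.tendsto_joinProb_mul_joinerStillWaiting hπ) (fun _ => zero_le) hle
  have hne := one_sub_pow_succ_ne_zero (missProb_lt_one hM.pH_pos) h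
  simpa [← mul_assoc, ENNReal.inv_mul_cancel hne (by finiteness)] using
    ENNReal.Tendsto.const_mul hscaled (.inr (ENNReal.inv_ne_top.2 hne))

theorem tendsto_meanStillWaiting : Tendsto (M.meanStillWaiting π) atTop (𝓝 0) := by
  rw [← tsum_zero (α := ENNReal) (β := ℕ)]
  refine tendsto_tsum_ennreal_of_dominated_convergence (bound := fun h : ℕ => π (h, 0) * h)
    ?_ (fun n h => ?_) fun h => ?_
  · rw [hM.tsum_mul_apply_zero hπ]
    exact balancedMean_ne_top (missProb_lt_one hM.pH_pos) hM.joinProb_lt_one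
  · gcongr
    exact mul_le_of_le_one_right' (hM.stillWaiting_le_one n _)
  · rcases h with _ | h
    · simp
    · simpa [mul_left_comm] using ENNReal.Tendsto.const_mul (a := ((h + 1 : ℕ) : ENNReal))
        (hM.tendsto_apply_mul_stillWaiting hπ h) (.inr (ENNReal.natCast_ne_top _))

/-- Little's law, with time counted in arrivals. -/
theorem joinProb_mul_tsum_joinerStillWaiting :
    M.joinProb * ∑' n, M.joinerStillWaiting π n = balancedMean (missProb M.pH) M.joinProb := by
  rw [← ENNReal.tsum_mul_left, tsum_eq_of_succ_add_eq (hM.meanStillWaiting_succ_add hπ)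
    (hM.tendsto_meanStillWaiting hπ), hM.meanStillWaiting_zero hπ]

theorem lamH_mul_meanWaitH :
    ENNReal.ofReal M.lamH * M.meanWaitH π = balancedMean (missProb M.pH) M.joinProb := by
  have hlam : ENNReal.ofReal (M.lamH + M.lamE) ≠ 0 := by simpa using hM.lam_add_pos
  have hmean : M.meanWaitH π = (ENNReal.ofReal (M.lamH + M.lamE))⁻¹ * (missProb M.pH ^ M.d *
      ∑' n, M.joinerStillWaiting π n) := by
    refine (hM.expect_eq_tsum_zero hπ _).trans ?_
    simp only [joinerStillWaiting]
    rw [ENNReal.tsum_comm]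
    simp_rw [ENNReal.tsum_mul_left, edges_apply_empty, Finset.card_range, hM.meanRemainingWait_eq,
      ← ENNReal.tsum_mul_left, join]
    refine tsum_congr fun h => tsum_congr fun n => ?_
    ring
  have hrate : ENNReal.ofReal M.lamH = ENNReal.ofReal (M.lamH + M.lamE) * M.typeProb .H :=
    (hM.lam_add_mul_typeProb .H).symm
  rw [← hM.joinProb_mul_tsum_joinerStillWaiting hπ, hmean, hrate, joinProb,
    mul_mul_mul_comm, ENNReal.mul_inv_cancel hlam ENNReal.ofReal_ne_top, one_mul, mul_assoc]

end SteadyState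

theorem lamH_mul_wH : ENNReal.ofReal M.lamH * M.wH = balancedMean (missProb M.pH) M.joinProb :=
  hM.lamH_mul_meanWaitH hM.isSteadyState_steadyState

theorem wH_ne_top : M.wH ≠ ⊤ := by
  have hmean := balancedMean_ne_top (missProb_lt_one hM.pH_pos) hM.joinProb_lt_one
  rw [← hM.lamH_mul_wH] at hmean
  rintro htop
  exact hmean (by rw [htop, ENNReal.mul_top (by simpa using hM.lamH_pos)])

end IsRegular

end Market

/-! ### The limit -/

theorem tendsto_tsum_pow_div_geom_sum {ι : Type*} {l : Filter ι} [l.IsCountablyGenerated]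
    {a q : ι → ℝ} {a₀ : ℝ} (ha : Tendsto a l (𝓝 a₀)) (ha₀ : |a₀| < 1) (hq : Tendsto q l (𝓝 1))
    (hq_nonneg : ∀ᶠ i in l, 0 ≤ q i) :
    Tendsto (fun i => ∑' m : ℕ, a i ^ (m + 1) / ∑ j ∈ Finset.range (m + 1), q i ^ j) l
      (𝓝 (-Real.log (1 - a₀))) := by
  obtain ⟨r, har, hr⟩ := exists_between ha₀
  have hr_nonneg : 0 ≤ r := (abs_nonneg a₀).trans har.le
  rw [← (Real.hasSum_pow_div_log_of_abs_lt_one ha₀).tsum_eq]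
  refine _root_.tendsto_tsum_of_dominated_convergence (bound := fun m => r ^ (m + 1))
    ((summable_geometric_of_lt_one hr_nonneg hr).comp_injective (add_left_injective 1))
    (fun m => ?_) ?_
  · have hsum : Tendsto (fun i => ∑ j ∈ Finset.range (m + 1), q i ^ j) l (𝓝 (m + 1)) := by
      simpa using tendsto_finsetSum (Finset.range (m + 1)) fun j _ => hq.pow j
    exact (ha.pow (m + 1)).div hsum (by positivity)
  · filter_upwards [ha.abs.eventually_le_const har, hq_nonneg] with i hai hqi m
    have hsum : 1 ≤ ∑ j ∈ Finset.range (m + 1), q i ^ j := by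
      rw [Finset.sum_range_succ']
      simpa using Finset.sum_nonneg fun j _ => pow_nonneg hqi (j + 1)
    rw [norm_div, norm_pow, Real.norm_eq_abs, Real.norm_of_nonneg (zero_le_one.trans hsum)]
    exact (div_le_self (by positivity) hsum).trans (by gcongr)

theorem toReal_balancedMean_mul {q a : ENNReal} (hq : q < 1) (ha : a < 1) :
    (1 - q.toReal) * (balancedMean q a).toReal =
      ∑' m : ℕ, a.toReal ^ (m + 1) / ∑ j ∈ Finset.range (m + 1), q.toReal ^ j := by
  have hq_lt : q.toReal < 1 := by
    simpa using ENNReal.toReal_strict_mono ENNReal.one_ne_top hq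
  rw [balancedMean, ENNReal.tsum_toReal_eq fun m =>
    ENNReal.ne_top_of_tsum_ne_top (balancedMean_ne_top hq ha) m, ← tsum_mul_left]
  refine tsum_congr fun m => ?_
  rw [ENNReal.toReal_div, ENNReal.toReal_pow,
    ENNReal.toReal_sub_of_le (pow_le_one₀ zero_le hq.le) ENNReal.one_ne_top, ENNReal.toReal_one,
    ENNReal.toReal_pow, geom_sum_eq hq_lt.ne, ← neg_div_neg_eq (_ - 1), neg_sub, neg_sub]
  field_simp

namespace Market

theorem IsRegular.joinProb_toReal {M : Market} (hM : M.IsRegular) :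
    M.joinProb.toReal = M.lamH / (M.lamH + M.lamE) * (1 - (M.pH : ℝ)) ^ M.d := by
  rw [joinProb, ENNReal.toReal_mul, ENNReal.toReal_pow, typeProb, lam, missProb,
    ENNReal.toReal_ofReal (sub_nonneg.2 M.pH.2.2),
    ENNReal.toReal_ofReal (div_nonneg hM.lamH_pos.le hM.lam_add_pos.le)]

theorem IsRegular.pH_mul_wH_toReal {M : Market} (hM : M.IsRegular) :
    (M.pH : ℝ) * M.wH.toReal =
      (∑' m : ℕ, (M.lamH / (M.lamH + M.lamE) * (1 - (M.pH : ℝ)) ^ M.d) ^ (m + 1) /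
        ∑ j ∈ Finset.range (m + 1), (1 - (M.pH : ℝ)) ^ j) / M.lamH := by
  have hmiss : (missProb M.pH).toReal = 1 - (M.pH : ℝ) :=
    ENNReal.toReal_ofReal (sub_nonneg.2 M.pH.2.2)
  have hmean := toReal_balancedMean_mul (missProb_lt_one hM.pH_pos) hM.joinProb_lt_one
  rw [← hM.lamH_mul_wH, ENNReal.toReal_mul, ENNReal.toReal_ofReal hM.lamH_pos.le, hmiss,
    sub_sub_cancel, hM.joinProb_toReal] at hmean
  rw [← hmean, mul_left_comm, mul_div_cancel_left₀ _ hM.lamH_pos.ne']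

theorem tendsto_pH_mul_wH {lamH lamE : ℝ} {d : ℕ} (hH : 0 < lamH) (hE : 0 < lamE) (hd : 1 ≤ d) :
    Tendsto (fun pH : unitInterval => (pH : ℝ) * (Market.mk lamH lamE pH 1 d).wH.toReal)
      (𝓝[>] (0 : unitInterval)) (𝓝 (Real.log (lamH / lamE + 1) / lamH)) := by
  have hq : Tendsto (fun pH : unitInterval => 1 - (pH : ℝ)) (𝓝[>] 0) (𝓝 1) := by
    have hcont : Continuous fun pH : unitInterval => 1 - (pH : ℝ) := by fun_prop
    simpa using (hcont.tendsto 0).mono_left nhdsWithin_le_nhds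
  have ha : Tendsto (fun pH : unitInterval => lamH / (lamH + lamE) * (1 - (pH : ℝ)) ^ d)
      (𝓝[>] 0) (𝓝 (lamH / (lamH + lamE))) := by
    simpa using (hq.pow d).const_mul (lamH / (lamH + lamE))
  have hfrac : |lamH / (lamH + lamE)| < 1 := by
    rw [abs_of_pos (by positivity), div_lt_one (by positivity)]
    linarith
  have hlog : -Real.log (1 - lamH / (lamH + lamE)) = Real.log (lamH / lamE + 1) := by
    rw [← Real.log_inv]
    congr 1
    field_simp [hE.ne']
    simp
  rw [← hlog]
  refine ((tendsto_tsum_pow_div_geom_sum ha hfrac hq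
    (.of_forall fun pH => sub_nonneg.2 pH.2.2)).div_const lamH).congr' ?_
  filter_upwards [self_mem_nhdsWithin] with pH hpH
  have hM : (Market.mk lamH lamE pH 1 d).IsRegular := ⟨hH, hE, hd, rfl, hpH⟩
  exact hM.pH_mul_wH_toReal.symm

end Market

theorem strictAntiOn_log_div_add_one_div_const {x : ℝ} (hx : 0 < x) :
    StrictAntiOn (fun y => Real.log (x / y + 1) / x) (Set.Ioi 0) := by
  intro y (hy : 0 < y) z (hz : 0 < z) hyz
  have hdiv : x / z < x / y := by gcongr
  simp only
  gcongr

theorem strictAntiOn_log_div_const_add_one_div {y : ℝ} (hy : 0 < y) :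
    StrictAntiOn (fun x => Real.log (x / y + 1) / x) (Set.Ioi 0) := by
  intro x (hx : 0 < x) z (hz : 0 < z) hxz
  have hslope := strictConcaveOn_log_Ioi.secant_strict_mono (a := 1) (x := x / y + 1)
    (y := z / y + 1) (Set.mem_Ioi.2 one_pos) (Set.mem_Ioi.2 (by positivity))
    (Set.mem_Ioi.2 (by positivity)) (by simp [hx.ne', hy.ne']) (by simp [hz.ne', hy.ne'])
    (by gcongr)
  simp only [Real.log_one, sub_zero, add_sub_cancel_right] at hslope
  have hscale : ∀ t, 0 < t → Real.log (t / y + 1) / t = Real.log (t / y + 1) / (t / y) / y :=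
    fun t ht => by field_simp
  simp only [hscale x hx, hscale z hz]
  gcongr

end ChainMatching

end

/-- With `p_E = 1` and `d ≥ 1` fixed: for `0 < p_H < 1` the steady state exists, is unique, and the
average waiting time is finite; `p_H * w_H` tends to `L lamH lamE = ln (lamH / lamE + 1) / lamH` as
`p_H → 0`, whatever `d` is; and this limit decreases in each arrival rate. -/
theorem mainTheorem4 :
    (∀ (lamH lamE : ℝ) (d : ℕ) (pH : unitInterval), 0 < lamH → 0 < lamE → 1 ≤ d →
      0 < pH → pH < 1 →
        (∃! π : PMF ChainMatching.State,
          (ChainMatching.Market.mk lamH lamE pH 1 d).IsSteadyState π) ∧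
        (ChainMatching.Market.mk lamH lamE pH 1 d).wH ≠ ⊤) ∧
    ∃ L : ℝ → ℝ → ℝ,
      (∀ (lamH lamE : ℝ) (d : ℕ), 0 < lamH → 0 < lamE → 1 ≤ d →
        Tendsto
          (fun pH : unitInterval =>
            (pH : ℝ) * (ChainMatching.Market.mk lamH lamE pH 1 d).wH.toReal)
          (𝓝[>] (0 : unitInterval)) (𝓝 (L lamH lamE))) ∧
      (∀ lamH lamE : ℝ, 0 < lamH → 0 < lamE →
        L lamH lamE = Real.log (lamH / lamE + 1) / lamH) ∧
      (∀ lamH : ℝ, 0 < lamH → StrictAntiOn (fun lamE => L lamH lamE) (Set.Ioi 0)) ∧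
      (∀ lamE : ℝ, 0 < lamE → StrictAntiOn (fun lamH => L lamH lamE) (Set.Ioi 0)) := by
  refine ⟨fun lamH lamE d pH hH hE hd hpH _ => ?_,
    fun lamH lamE => Real.log (lamH / lamE + 1) / lamH,
    fun _ _ _ => ChainMatching.Market.tendsto_pH_mul_wH,
    fun _ _ _ _ => rfl,
    fun _ => ChainMatching.strictAntiOn_log_div_add_one_div_const,
    fun _ => ChainMatching.strictAntiOn_log_div_const_add_one_div⟩
  have hM : (ChainMatching.Market.mk lamH lamE pH 1 d).IsRegular := ⟨hH, hE, hd, rfl, hpH⟩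
  exact ⟨hM.existsUnique_isSteadyState, hM.wH_ne_top⟩
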